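/- Let $p$ be a prime number, let $G$ be a (discrete) group and let $H$ be a subgroup of $G$. A group $\Gamma$ is called *cohomologically $p$-complete* if for every $n\ge 0$ the canonical homomorphism, induced by inflation, $$\varinjlim_{N} H^n(\Gamma/N;\mathbb{Z}/p\mathbb{Z})\longrightarrow H^n(\Gamma;\mathbb{Z}/p\mathbb{Z})$$ is an isomorphism, where $N$ runs through the normal subgroups of $\Gamma$ whose index is a power of $p$, directed by reverse inclusion, and the coefficients are trivial. (The left-hand side is the Galois cohomology $\hat H^n(\hat\Gamma^p;\mathbb{Z}/p\mathbb{Z})$ of the pro-$p$ completion of $\Gamma$.) A group $\Gamma$ *has enough torsion-free quotients for the prime $p$* if for each normal subgroup $V$ of $\Gamma$ with $\Gamma/V$ a finite $p$-group there exists a subgroup $U\subseteq V$, normal in $\Gamma$, such that $\Gamma/U$ is torsion-free and elementary amenable. (The elementary amenable groups form the smallest class of groups containing all finite and all abelian groups and closed under isomorphisms, subgroups, quotients, extensions and directed unions.) 1. Suppose that $H$ is normal in $G$ and that the index of $H$ in $G$ is a power of $p$. If $G$ is cohomologically $p$-complete, then $H$ is cohomologically $p$-complete. If $G$ has enough torsion-free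 quotients for the prime $p$, then so has $H$. 2. Suppose that $H$ is a retract of $G$, i.e. there is a homomorphism $\pi\colon G\to H$ with $\pi|_H=\mathrm{id}_H$. If $G$ is cohomologically $p$-complete, then $H$ is cohomologically $p$-complete. If $G$ has enough torsion-free quotients for the prime $p$, then so has $H$. -/

import Mathlib

universe u

open CategoryTheory

section ModPCohomology

/-- The ring `ℤ/pℤ`, lifted to the universe of the group under consideration. -/
abbrev CoeffModP (p : ℕ) : Type u := ULift.{u} (ZMod p)

/-- The trivial representation `ℤ/pℤ` of `G`. -/
noncomputable abbrev trivialModP (p : ℕ) (G : Type u) [Group G] : Rep.{u} (CoeffModP.{u} p) G :=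
  Rep.trivial (CoeffModP.{u} p) G (CoeffModP.{u} p)

/-- The group cohomology `Hⁿ(G; ℤ/pℤ)` with trivial coefficients. -/
noncomputable abbrev modPCohomology (p : ℕ) (G : Type u) [Group G] (n : ℕ) :
    ModuleCat.{u} (CoeffModP.{u} p) :=
  groupCohomology (trivialModP p G) n

/-- The map `f* : Hⁿ(Q; ℤ/pℤ) → Hⁿ(G; ℤ/pℤ)` induced by a homomorphism `f : G → Q` (and the
identity on coefficients). -/
noncomputable abbrev modPCohomologyMap (p : ℕ) {G Q : Type u} [Group G] [Group Q] (f : G →* Q)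
    (n : ℕ) : modPCohomology p Q n ⟶ modPCohomology p G n :=
  groupCohomology.map (A := trivialModP p Q) (B := trivialModP p G) f
    (𝟙 (trivialModP p G)) n

theorem modPCohomologyMap_comp (p : ℕ) {G Q R : Type u} [Group G] [Group Q] [Group R]
    (f : G →* Q) (g : Q →* R) (n : ℕ) :
    modPCohomologyMap p (g.comp f) n = modPCohomologyMap p g n ≫ modPCohomologyMap p f n :=
  groupCohomology.map_comp (A := trivialModP p R) (B := trivialModP p Q) (C := trivialModP p G)
    g f (𝟙 (trivialModP p Q)) (𝟙 (trivialModP p G)) n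

end ModPCohomology

section CohomologicalCompleteness

/-- The index set of the system of finite `p`-group quotients of `G`: the normal subgroups of `G`
whose index is a power of `p`. -/
structure PPowerNormalSubgroup (p : ℕ) (G : Type u) [Group G] where
  /-- the underlying subgroup -/
  toSubgroup : Subgroup G
  normal : toSubgroup.Normal
  index_eq : ∃ k : ℕ, toSubgroup.index = p ^ k

namespace PPowerNormalSubgroup

variable {p : ℕ} {G : Type u} [Group G]

instance (N : PPowerNormalSubgroup p G) : N.toSubgroup.Normal := N.normal

/-- Smaller subgroups (that is, larger quotients) come later. -/
instance : Preorder (PPowerNormalSubgroup p G) where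
  le M N := N.toSubgroup ≤ M.toSubgroup
  le_refl M := le_refl M.toSubgroup
  le_trans _ _ _ h₁ h₂ := le_trans h₂ h₁

instance : Nonempty (PPowerNormalSubgroup p G) :=
  ⟨⟨⊤, inferInstance, 0, by simp⟩⟩

instance [hp : Fact p.Prime] : IsDirectedOrder (PPowerNormalSubgroup p G) where
  directed M N := by
    obtain ⟨k, hk⟩ := M.index_eq
    obtain ⟨l, hl⟩ := N.index_eq
    have h : N.toSubgroup.relIndex M.toSubgroup ∣ p ^ l :=
      hl ▸ Subgroup.relIndex_dvd_index_of_normal N.toSubgroup M.toSubgroup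
    obtain ⟨m, -, hm⟩ := (Nat.dvd_prime_pow hp.out).1 h
    refine ⟨⟨M.toSubgroup ⊓ N.toSubgroup, inferInstance, m + k, ?_⟩,
      inf_le_left (a := M.toSubgroup), inf_le_right (a := M.toSubgroup)⟩
    rw [pow_add, ← hm, ← hk, ← Subgroup.inf_relIndex_left]
    exact (Subgroup.relIndex_mul_index inf_le_left).symm

/-- The projection `G/N → G/M` for `N ≤ M`. -/
def proj {M N : PPowerNormalSubgroup p G} (h : M ≤ N) :
    G ⧸ N.toSubgroup →* G ⧸ M.toSubgroup :=
  QuotientGroup.map N.toSubgroup M.toSubgroup (MonoidHom.id G) h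

/-- The transition map `Hⁿ(G/M; ℤ/pℤ) → Hⁿ(G/N; ℤ/pℤ)` for `N ≤ M`. -/
noncomputable def transition (n : ℕ) (M N : PPowerNormalSubgroup p G) (h : M ≤ N) :
    modPCohomology p (G ⧸ M.toSubgroup) n →ₗ[CoeffModP.{u} p]
      modPCohomology p (G ⧸ N.toSubgroup) n :=
  (modPCohomologyMap p (proj h) n).hom

/-- The inflation map `Hⁿ(G/N; ℤ/pℤ) → Hⁿ(G; ℤ/pℤ)`. -/
noncomputable def inflation (n : ℕ) (N : PPowerNormalSubgroup p G) :
    modPCohomology p (G ⧸ N.toSubgroup) n →ₗ[CoeffModP.{u} p] modPCohomology p G n :=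
  (modPCohomologyMap p (QuotientGroup.mk' N.toSubgroup) n).hom

theorem inflation_transition (n : ℕ) (M N : PPowerNormalSubgroup p G) (h : M ≤ N)
    (x : modPCohomology p (G ⧸ M.toSubgroup) n) :
    inflation n N (transition n M N h x) = inflation n M x := by
  have key := modPCohomologyMap_comp p (QuotientGroup.mk' N.toSubgroup) (proj h) n
  have hc : (proj h).comp (QuotientGroup.mk' N.toSubgroup) = QuotientGroup.mk' M.toSubgroup := by
    ext; rfl
  rw [hc] at key
  simp only [inflation, transition, key, ModuleCat.hom_comp, LinearMap.comp_apply]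

instance (n : ℕ) : DirectedSystem
    (fun N : PPowerNormalSubgroup p G => modPCohomology p (G ⧸ N.toSubgroup) n)
    (fun M N h => transition n M N h) where
  map_self M x := by
    have hc : proj (le_refl M) = MonoidHom.id (G ⧸ M.toSubgroup) := by
      ext; rfl
    simp only [transition, hc]
    rw [modPCohomologyMap, groupCohomology.map_id]
    rfl
  map_map K N M h₁ h₂ x := by
    have key := modPCohomologyMap_comp p (proj h₂) (proj h₁) n
    have hc : (proj h₁).comp (proj h₂) = proj (le_trans h₁ h₂) := by
      ext; rfl
    rw [hc] at key
    simp only [transition, key, ModuleCat.hom_comp, LinearMap.comp_apply]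

end PPowerNormalSubgroup

open Classical in
/-- `Ĥⁿ(Ĝᵖ; ℤ/pℤ)`, the Galois cohomology of the pro-`p` completion of `G`: the direct limit of
`Hⁿ(G/N; ℤ/pℤ)` over the finite `p`-group quotients `G/N` of `G`. -/
noncomputable abbrev proPCohomology (p : ℕ) (G : Type u) [Group G] (n : ℕ) : Type u :=
  Module.DirectLimit (R := CoeffModP.{u} p) (ι := PPowerNormalSubgroup p G)
    (fun N => modPCohomology p (G ⧸ N.toSubgroup) n)
    (PPowerNormalSubgroup.transition n)

open Classical in
/-- The canonical homomorphism `Ĥⁿ(Ĝᵖ; ℤ/pℤ) → Hⁿ(G; ℤ/pℤ)`, induced by the inflation maps. -/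
noncomputable def proPComparison (p : ℕ) (G : Type u) [Group G] (n : ℕ) :
    proPCohomology p G n →ₗ[CoeffModP.{u} p] modPCohomology p G n :=
  Module.DirectLimit.lift (CoeffModP.{u} p) (PPowerNormalSubgroup p G)
    (fun N => modPCohomology p (G ⧸ N.toSubgroup) n)
    (PPowerNormalSubgroup.transition n)
    (PPowerNormalSubgroup.inflation n)
    (PPowerNormalSubgroup.inflation_transition n)

/-- `G` is cohomologically `p`-complete: the canonical homomorphism
`Ĥ*(Ĝᵖ; ℤ/pℤ) → H*(G; ℤ/pℤ)` is an isomorphism (in every degree). -/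
def CohomologicallyPComplete (p : ℕ) (G : Type u) [Group G] : Prop :=
  ∀ n : ℕ, Function.Bijective (proPComparison p G n)

end CohomologicalCompleteness

section TorsionFreeQuotients

/-- The class of elementary amenable groups: the smallest class of groups which contains all
finite and all abelian groups and is closed under isomorphisms, subgroups, quotients, extensions
and directed unions. Isomorphism closure is the special case of a bijective homomorphism in
`of_injective` (or `of_surjective`). -/
inductive IsElementaryAmenable : ∀ (G : Type u) [Group G], Prop
  | of_finite (G : Type u) [Group G] (h : Finite G) : IsElementaryAmenable G
  | of_abelian (G : Type u) [Group G] (h : ∀ a b : G, a * b = b * a) : IsElementaryAmenable G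
  | of_injective {G K : Type u} [Group G] [Group K] (f : K →* G) (hf : Function.Injective f)
      (h : IsElementaryAmenable G) : IsElementaryAmenable K
  | of_surjective {G Q : Type u} [Group G] [Group Q] (f : G →* Q) (hf : Function.Surjective f)
      (h : IsElementaryAmenable G) : IsElementaryAmenable Q
  | of_extension {G : Type u} [Group G] (N : Subgroup G) [N.Normal]
      (hN : IsElementaryAmenable N) (hQ : IsElementaryAmenable (G ⧸ N)) : IsElementaryAmenable G
  | of_directed_union {G : Type u} [Group G] (S : Set (Subgroup G)) (hne : S.Nonempty)
      (hdir : DirectedOn (· ≤ ·) S) (hcover : ∀ g : G, ∃ K ∈ S, g ∈ K)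
      (h : ∀ K ∈ S, IsElementaryAmenable K) : IsElementaryAmenable G

/-- `G` is torsion-free: the only element of finite order is the identity. (For a non-commutative
group this is weaker than injectivity of the power maps.) -/
def IsTorsionFreeGroup (G : Type u) [Group G] : Prop :=
  ∀ g : G, IsOfFinOrder g → g = 1

/-- `G` has enough torsion-free quotients for the prime `p`: for each normal subgroup `V` of `G`
with `G/V` a finite `p`-group there is a subgroup `U ≤ V`, normal in `G`, with `G/U` torsion-free
and elementary amenable. -/
def HasEnoughTorsionFreeQuotients (p : ℕ) (G : Type u) [Group G] : Prop :=
  ∀ (V : Subgroup G) [V.Normal], Finite (G ⧸ V) → IsPGroup p (G ⧸ V) →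
    ∃ (U : Subgroup G) (_ : U.Normal), U ≤ V ∧
      IsTorsionFreeGroup (G ⧸ U) ∧ IsElementaryAmenable (G ⧸ U)

end TorsionFreeQuotients

/-- `H` is a retract of `G`: there is a homomorphism `π : G → H` restricting to the identity
on `H`. -/
def Subgroup.IsRetractOf {G : Type u} [Group G] (H : Subgroup G) : Prop :=
  ∃ π : G →* H, ∀ h : H, π h = h

/-! Call a cochain on $G$ continuous if it factors through a finite $p$-group quotient. Continuous
cochains form a subcomplex computing $\varinjlim_N H^n(G/N)$, so $G$ is cohomologically $p$-complete
exactly when the quotient of all cochains by continuous ones is acyclic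
(`CohomologicallyPComplete.isAcyclic` and `Rep.IsAcyclicModPQuotients.cohomologicallyPComplete`).
This criterion makes sense for any coefficient module.

It passes to extensions of modules (`of_shortExact`). A finite $\mathbb F_p$-module on which $G$
acts through a finite $p$-group is an iterated extension of copies of the trivial module $\mathbb
F_p$, so acyclicity for $\mathbb F_p$ implies it for every such module (`of_finite`). For normal $H$
of $p$-power index this applies to the functions on $G/H$, and Shapiro's lemma, realised by explicit
cochain maps preserving continuity, carries the conclusion to $H$. For a retract, the cochains of
$H$ are already a direct factor of those of $G$.

For torsion-free quotients, a given $V$ in $H$ contains $W\cap H$ for some normal $W$ of $p$-power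
index in $G$: the core of $V$ in the normal case, $\pi^{-1}(V)$ in the retract case. If $U\le W$ is
suitable for $G$, then $H/(U\cap H)$ embeds in $G/U$. -/

section CohomologyClasses

/-! ### Cohomology classes represented by inhomogeneous cocycles -/

namespace groupCohomology

variable {k G : Type u} [CommRing k] [Group G] {A : Rep.{u} k G}

theorem exists_π_cocyclesMk_eq {n : ℕ} (x : groupCohomology A n) :
    ∃ (f : (Fin n → G) → A) (h : inhomogeneousCochains.d A n f = 0),
      π A n (cocyclesMk f h) = x := by
  induction x using groupCohomology_induction_on with
  | h z =>
    have hz : inhomogeneousCochains.d A n (iCocycles A n z) = 0 := by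
      have := congr($((inhomogeneousCochains A).iCycles_d n (n + 1)) z)
      simpa [inhomogeneousCochains.d_def] using this
    refine ⟨iCocycles A n z, hz, congrArg _ ?_⟩
    apply (ModuleCat.mono_iff_injective (iCocycles A n)).1 inferInstance
    exact iCocycles_mk _ hz

theorem π_eq_zero_iff_exists_toCocycles {i j : ℕ} (hij : (ComplexShape.up ℕ).prev j = i)
    (z : cocycles A j) :
    π A j z = 0 ↔ ∃ g, toCocycles A i j g = z := by
  have := ((ShortComplex.mk _ _
    ((inhomogeneousCochains A).toCycles_comp_homologyπ i j)).exact_of_g_is_cokernel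
      ((inhomogeneousCochains A).homologyIsCokernel i j hij))
  rw [ShortComplex.moduleCat_exact_iff_range_eq_ker] at this
  exact (SetLike.ext_iff.1 this z).symm

theorem π_cocyclesMk_eq_zero_iff {n : ℕ} (f : (Fin (n + 1) → G) → A)
    (h : inhomogeneousCochains.d A (n + 1) f = 0) :
    π A (n + 1) (cocyclesMk f h) = 0 ↔ ∃ g, inhomogeneousCochains.d A n g = f := by
  rw [π_eq_zero_iff_exists_toCocycles (i := n) (by simp)]
  refine exists_congr fun g => ?_
  rw [← ((ModuleCat.mono_iff_injective (iCocycles A (n + 1))).1 inferInstance).eq_iff,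
    iCocycles_mk]
  have := congr($((inhomogeneousCochains A).toCycles_i n (n + 1)) g)
  rw [inhomogeneousCochains.d_def] at this
  exact this ▸ Iff.rfl

theorem π_zero_cocyclesMk_eq_zero_iff (f : (Fin 0 → G) → A)
    (h : inhomogeneousCochains.d A 0 f = 0) :
    π A 0 (cocyclesMk f h) = 0 ↔ f = 0 := by
  rw [π_eq_zero_iff_exists_toCocycles (i := 0) (by simp)]
  -- The predecessor of 0 is 0 by convention, and there is no differential from degree 0 to itself.
  have h0 : toCocycles A 0 0 = 0 := by
    rw [← cancel_mono (iCocycles A 0), HomologicalComplex.toCycles_i,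
      HomologicalComplex.shape _ _ _ (by simp), Limits.zero_comp]
  have h1 := iCocycles_mk f h
  constructor
  · rintro ⟨g, hg⟩
    rw [← h1, ← hg, h0]
    simp
  · rintro rfl
    refine ⟨0, ?_⟩
    apply (ModuleCat.mono_iff_injective (iCocycles A 0)).1 inferInstance
    rw [h1]
    simp

theorem map_π_cocyclesMk {H : Type u} [Group H] {B : Rep.{u} k H} (f : H →* G)
    (φ : Rep.res f A ⟶ B) {n : ℕ} (z : (Fin n → G) → A)
    (h : inhomogeneousCochains.d A n z = 0)
    (h' : inhomogeneousCochains.d B n (fun x => φ.hom (z (f ∘ x))) = 0) :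
    map f φ n (π A n (cocyclesMk z h)) =
      π B n (cocyclesMk (fun x => φ.hom (z (f ∘ x))) h') := by
  rw [π_map_apply]
  congr 1
  apply (ModuleCat.mono_iff_injective (iCocycles B n)).1 inferInstance
  rw [iCocycles_mk]
  have := congr($(HomologicalComplex.cyclesMap_i (cochainsMap f φ) n) (cocyclesMk z h))
  refine this.trans ?_
  have h1 := iCocycles_mk z h
  simp only [ModuleCat.hom_comp, LinearMap.comp_apply]
  rw [h1]
  rfl

theorem d_cochainsMap {H : Type u} [Group H] {B : Rep.{u} k H} (f : H →* G)
    (φ : Rep.res f A ⟶ B) {n : ℕ} (z : (Fin n → G) → A) :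
    inhomogeneousCochains.d B n (fun x => φ.hom (z (f ∘ x))) =
      fun x => φ.hom (inhomogeneousCochains.d A n z (f ∘ x)) := by
  have := congr($((cochainsMap f φ).comm n (n + 1)) z)
  rw [inhomogeneousCochains.d_def, inhomogeneousCochains.d_def] at this
  exact this

end groupCohomology

end CohomologyClasses

/-! ### Bijectivity of the comparison map in terms of elements -/

section ElementwiseCriterion

variable {p : ℕ} {G : Type u} [Group G]

open Classical in
theorem proPComparison_of (n : ℕ) (N : PPowerNormalSubgroup p G)
    (x : modPCohomology p (G ⧸ N.toSubgroup) n) :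
    proPComparison p G n (Module.DirectLimit.of _ _ _ _ N x) =
      PPowerNormalSubgroup.inflation n N x :=
  Module.DirectLimit.lift_of _ _ _

open Classical in
theorem proPComparison_surjective_iff [Fact p.Prime] (n : ℕ) :
    Function.Surjective (proPComparison p G n) ↔
      ∀ y, ∃ (N : PPowerNormalSubgroup p G) (x : modPCohomology p (G ⧸ N.toSubgroup) n),
        PPowerNormalSubgroup.inflation n N x = y := by
  refine forall_congr' fun y => ⟨?_, ?_⟩
  · rintro ⟨x, rfl⟩
    obtain ⟨N, x, rfl⟩ := Module.DirectLimit.exists_of x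
    exact ⟨N, x, (proPComparison_of n N x).symm⟩
  · rintro ⟨N, x, rfl⟩
    exact ⟨_, proPComparison_of n N x⟩

open Classical in
theorem proPComparison_injective_iff [Fact p.Prime] (n : ℕ) :
    Function.Injective (proPComparison p G n) ↔
      ∀ (N : PPowerNormalSubgroup p G) (x : modPCohomology p (G ⧸ N.toSubgroup) n),
        PPowerNormalSubgroup.inflation n N x = 0 →
          ∃ (M : PPowerNormalSubgroup p G) (h : N ≤ M),
            PPowerNormalSubgroup.transition n N M h x = 0 := by
  rw [injective_iff_map_eq_zero]
  constructor
  · intro H N x hx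
    rw [← proPComparison_of] at hx
    exact Module.DirectLimit.of.zero_exact (H _ hx)
  · intro H y hy
    obtain ⟨N, x, rfl⟩ := Module.DirectLimit.exists_of y
    rw [proPComparison_of] at hy
    obtain ⟨M, h, hM⟩ := H N x hy
    rw [← Module.DirectLimit.of_f (hij := h), hM, map_zero]

end ElementwiseCriterion

/-! ### Subgroups of `p`-power index: preimages and cores -/

namespace PPowerNormalSubgroup

variable {p : ℕ} {G H : Type u} [Group G] [Group H]

/-- The preimage of a normal subgroup of `p`-power index under a homomorphism. -/
def comap [hp : Fact p.Prime] (f : H →* G) (N : PPowerNormalSubgroup p G) :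
    PPowerNormalSubgroup p H where
  toSubgroup := N.toSubgroup.comap f
  normal := inferInstance
  index_eq := by
    obtain ⟨k, hk⟩ := N.index_eq
    rw [Subgroup.index_comap]
    have := Subgroup.relIndex_dvd_index_of_normal N.toSubgroup f.range
    rw [hk, Nat.dvd_prime_pow hp.out] at this
    exact this.imp fun _ h => h.2

end PPowerNormalSubgroup

/-- The core of a finite-index subgroup has finite index, so it suffices that the quotient is a
$p$-group. Every conjugate of $g$ has its $p^k$-th power in $H$, and the $p^l$-th power of that lies
in $V$; hence $g^{p^{k+l}}$ is in the core. -/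
theorem Subgroup.exists_index_normalCore_map_eq_pow {G : Type u} [Group G] {p : ℕ}
    [hp : Fact p.Prime] {H : Subgroup G} [H.Normal] (hH : ∃ k : ℕ, H.index = p ^ k)
    (V : Subgroup H) [V.Normal] (hV : ∃ k : ℕ, V.index = p ^ k) :
    ∃ k : ℕ, (V.map H.subtype).normalCore.index = p ^ k := by
  obtain ⟨k, hk⟩ := hH
  obtain ⟨l, hl⟩ := hV
  have hidx : (V.map H.subtype).index = p ^ (l + k) := by
    rw [Subgroup.index_map_subtype, hk, hl, pow_add]
  have : (V.map H.subtype).FiniteIndex := ⟨by rw [hidx]; exact pow_ne_zero _ hp.out.ne_zero⟩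
  have hpG : IsPGroup p (G ⧸ (V.map H.subtype).normalCore) := by
    intro x
    induction x using QuotientGroup.induction_on with
    | H g =>
    refine ⟨k + l, ?_⟩
    rw [← QuotientGroup.mk_pow, QuotientGroup.eq_one_iff]
    intro b
    have h1 : (b * g * b⁻¹) ^ p ^ k ∈ H := hk ▸ Subgroup.pow_index_mem H _
    have h2 : (⟨_, h1⟩ : H) ^ p ^ l ∈ V := hl ▸ Subgroup.pow_index_mem V _
    refine ⟨_, h2, ?_⟩
    simp [pow_add, pow_mul]
  exact IsPGroup.iff_card.1 hpG

namespace PPowerNormalSubgroup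

/-- For `H` normal of `p`-power index in `G` and `N` normal of `p`-power index in `H`, the
intersection of the `G`-conjugates of `N`. -/
def core {p : ℕ} [Fact p.Prime] {G : Type u} [Group G] (H : PPowerNormalSubgroup p G)
    (N : PPowerNormalSubgroup p H.toSubgroup) : PPowerNormalSubgroup p G where
  toSubgroup := (N.toSubgroup.map H.toSubgroup.subtype).normalCore
  normal := inferInstance
  index_eq := Subgroup.exists_index_normalCore_map_eq_pow H.index_eq N.toSubgroup N.index_eq

end PPowerNormalSubgroup

/-! ### Cochains factoring through finite `p`-group quotients -/

section FactorsThroughPQuotient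

/-- The function `f` of several variables in `G` factors through a finite `p`-group quotient of
`G`. -/
def FactorsThroughPQuotient (p : ℕ) {G : Type u} [Group G] {X : Type*} {n : ℕ}
    (f : (Fin n → G) → X) : Prop :=
  ∃ N : PPowerNormalSubgroup p G,
    ∀ x y : Fin n → G, (∀ i, (x i)⁻¹ * y i ∈ N.toSubgroup) → f x = f y

namespace FactorsThroughPQuotient

variable {p : ℕ} {G H : Type u} [Group G] [Group H] {X Y Z : Type*} {n : ℕ}

theorem of_quotient (N : PPowerNormalSubgroup p G) (e : (Fin n → G ⧸ N.toSubgroup) → X) :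
    FactorsThroughPQuotient p fun x : Fin n → G => e (QuotientGroup.mk' N.toSubgroup ∘ x) :=
  ⟨N, fun _ _ h => congrArg e (funext fun i => QuotientGroup.eq.2 (h i))⟩

theorem exists_quotient {f : (Fin n → G) → X} (hf : FactorsThroughPQuotient p f) :
    ∃ (N : PPowerNormalSubgroup p G) (e : (Fin n → G ⧸ N.toSubgroup) → X),
      f = fun x => e (QuotientGroup.mk' N.toSubgroup ∘ x) := by
  obtain ⟨N, hN⟩ := hf
  refine ⟨N, fun y => f fun i => (y i).out, funext fun x => (hN _ _ fun i => ?_)⟩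
  rw [← QuotientGroup.eq]
  simp

theorem of_fin_zero (f : (Fin 0 → G) → X) : FactorsThroughPQuotient p f :=
  ⟨Classical.arbitrary _, fun x y _ => congrArg f (Subsingleton.elim x y)⟩

theorem exists_le {f : (Fin n → G) → X} [Fact p.Prime] (hf : FactorsThroughPQuotient p f)
    (K : PPowerNormalSubgroup p G) :
    ∃ N : PPowerNormalSubgroup p G, K ≤ N ∧
      ∀ x y : Fin n → G, (∀ i, (x i)⁻¹ * y i ∈ N.toSubgroup) → f x = f y := by
  obtain ⟨M, hM⟩ := hf
  obtain ⟨N, h1, h2⟩ := exists_ge_ge K M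
  exact ⟨N, h1, fun x y h => hM x y fun i => h2 (h i)⟩

theorem map {f : (Fin n → G) → X} (hf : FactorsThroughPQuotient p f) (e : X → Y) :
    FactorsThroughPQuotient p fun x => e (f x) :=
  hf.imp fun _ h x y hxy => congrArg e (h x y hxy)

theorem map₂ [Fact p.Prime] {f : (Fin n → G) → X} {g : (Fin n → G) → Y}
    (hf : FactorsThroughPQuotient p f) (hg : FactorsThroughPQuotient p g) (e : X → Y → Z) :
    FactorsThroughPQuotient p fun x => e (f x) (g x) := by
  obtain ⟨M, hM⟩ := hf
  obtain ⟨N, hMN, hN⟩ := hg.exists_le M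
  exact ⟨N, fun x y h => congrArg₂ e (hM x y fun i => hMN (h i)) (hN x y h)⟩

theorem comp_hom [Fact p.Prime] {f : (Fin n → G) → X} (hf : FactorsThroughPQuotient p f)
    (φ : H →* G) : FactorsThroughPQuotient p fun x : Fin n → H => f (φ ∘ x) := by
  obtain ⟨N, hN⟩ := hf
  refine ⟨N.comap φ, fun x y h => hN _ _ fun i => ?_⟩
  simpa [PPowerNormalSubgroup.comap] using h i

theorem of_injective_comp {f : (Fin n → G) → X} {e : X → Y} (he : Function.Injective e)
    (hf : FactorsThroughPQuotient p fun x => e (f x)) : FactorsThroughPQuotient p f :=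
  hf.imp fun _ h x y hxy => he (h x y hxy)

end FactorsThroughPQuotient

end FactorsThroughPQuotient

/-- Contraction commutes with the projection to $G/N$, where $x$ and $y$ agree. -/
theorem Fin.inv_contractNth_mul_mem {G : Type*} [Group G] (N : Subgroup G) [N.Normal] {n : ℕ}
    {x y : Fin (n + 1) → G} (h : ∀ i, (x i)⁻¹ * y i ∈ N) (j : Fin (n + 1)) (i : Fin n) :
    (Fin.contractNth j (· * ·) x i)⁻¹ * Fin.contractNth j (· * ·) y i ∈ N := by
  rw [← QuotientGroup.eq]
  have hxy : (QuotientGroup.mk' N) ∘ x = (QuotientGroup.mk' N) ∘ y :=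
    funext fun i => QuotientGroup.eq.2 (h i)
  have h1 := fun z => congrFun (Fin.comp_contractNth (f := QuotientGroup.mk' N) (· * ·) (· * ·)
    (fun a b => map_mul _ a b) j z) i
  exact (h1 x).trans ((hxy ▸ rfl : _ = _).trans (h1 y).symm)

/-! ### Acyclicity modulo continuous cochains -/

section Acyclicity

variable {k G : Type u} [CommRing k] [Group G]

/-- The representation `A` of `G` factors through a finite `p`-group quotient of `G`. -/
def Rep.ActsThroughPQuotient (p : ℕ) (A : Rep.{u} k G) : Prop :=
  ∃ K : PPowerNormalSubgroup p G, ∀ g ∈ K.toSubgroup, A.ρ g = 1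

/-- The differential lets the first variable act on $A$, so the witnessing subgroup is shrunk into
one acting trivially. -/
theorem FactorsThroughPQuotient.d {p : ℕ} [Fact p.Prime] {A : Rep.{u} k G}
    (hA : A.ActsThroughPQuotient p) {n : ℕ} {f : (Fin n → G) → A}
    (hf : FactorsThroughPQuotient p f) :
    FactorsThroughPQuotient p (X := A) (inhomogeneousCochains.d A n f) := by
  obtain ⟨K, hK⟩ := hA
  obtain ⟨N, hKN, hN⟩ := hf.exists_le K
  refine ⟨N, fun x y h => ?_⟩
  rw [inhomogeneousCochains.d_hom_apply, inhomogeneousCochains.d_hom_apply]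
  have h0 : A.ρ (y 0) = A.ρ (x 0) := by
    have := hK _ (hKN (h 0))
    rw [← mul_inv_cancel_left (x 0) (y 0), map_mul, this, mul_one]
  congr 1
  · rw [h0, hN _ _ fun i => h i.succ]
  · exact Finset.sum_congr rfl fun j _ =>
      congrArg _ (hN _ _ (Fin.inv_contractNth_mul_mem _ h j))

/-- The inclusion of the complex of cochains which factor through finite `p`-group quotients of `G`
into the complex of all cochains with values in `A` has acyclic cokernel. -/
def Rep.IsAcyclicModPQuotients (p : ℕ) (A : Rep.{u} k G) : Prop :=
  ∀ (n : ℕ) (f : (Fin (n + 1) → G) → A),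
    FactorsThroughPQuotient p (X := A) (inhomogeneousCochains.d A (n + 1) f) →
      ∃ g : (Fin n → G) → A,
        FactorsThroughPQuotient p (f - (inhomogeneousCochains.d A n g : (Fin (n + 1) → G) → A))

end Acyclicity

namespace groupCohomology

variable {k G : Type u} [CommRing k] [Group G] {A : Rep.{u} k G}

theorem π_cocyclesMk_eq_iff {n : ℕ} (f f' : (Fin (n + 1) → G) → A)
    (h : inhomogeneousCochains.d A (n + 1) f = 0)
    (h' : inhomogeneousCochains.d A (n + 1) f' = 0) :
    π A (n + 1) (cocyclesMk f h) = π A (n + 1) (cocyclesMk f' h') ↔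
      ∃ g, inhomogeneousCochains.d A n g = f - f' := by
  have hs : inhomogeneousCochains.d A (n + 1) (f - f') = 0 := by
    refine (map_sub (inhomogeneousCochains.d A (n + 1)).hom f f').trans ?_
    rw [h, h', sub_zero]
  rw [← sub_eq_zero, ← map_sub, ← π_cocyclesMk_eq_zero_iff _ hs]
  suffices cocyclesMk f h - cocyclesMk f' h' = cocyclesMk (f - f') hs by rw [this]
  apply (ModuleCat.mono_iff_injective (iCocycles A (n + 1))).1 inferInstance
  rw [map_sub, iCocycles_mk, iCocycles_mk, iCocycles_mk]

theorem inhomogeneousCochains_d_d {n : ℕ} (f : (Fin n → G) → A) :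
    inhomogeneousCochains.d A (n + 1) (inhomogeneousCochains.d A n f) = 0 :=
  congr($(inhomogeneousCochains.d_comp_d A (n := n)) f)

end groupCohomology

open groupCohomology

/-! ### Completeness is equivalent to acyclicity -/

section CompletenessCriterion

variable {p : ℕ} {G Q : Type u} [Group G] [Group Q]

theorem trivialModP_d_comp (f : G →* Q) {n : ℕ} (z : (Fin n → Q) → CoeffModP.{u} p) :
    inhomogeneousCochains.d (trivialModP p G) n (fun x => z (f ∘ x)) =
      fun x : Fin (n + 1) → G => inhomogeneousCochains.d (trivialModP p Q) n z (f ∘ x) :=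
  d_cochainsMap (A := trivialModP p Q) (B := trivialModP p G) f (𝟙 (trivialModP p G)) z

theorem trivialModP_d_comp_eq_zero_iff {f : G →* Q} (hf : Function.Surjective f) {n : ℕ}
    (z : (Fin n → Q) → CoeffModP.{u} p) :
    inhomogeneousCochains.d (trivialModP p G) n (fun x => z (f ∘ x)) = 0 ↔
      inhomogeneousCochains.d (trivialModP p Q) n z = 0 := by
  rw [trivialModP_d_comp]
  constructor
  · intro h
    funext y
    obtain ⟨x, rfl⟩ := hf.comp_left y
    exact congrFun h x
  · intro h
    funext x
    exact congrFun h (f ∘ x)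

theorem modPCohomologyMap_π_cocyclesMk (f : G →* Q) {n : ℕ}
    (z : (Fin n → Q) → CoeffModP.{u} p)
    (h : inhomogeneousCochains.d (trivialModP p Q) n z = 0)
    (h' : inhomogeneousCochains.d (trivialModP p G) n (fun x => z (f ∘ x)) = 0) :
    modPCohomologyMap p f n (π (trivialModP p Q) n (cocyclesMk z h)) =
      π (trivialModP p G) n (cocyclesMk (fun x => z (f ∘ x)) h') :=
  map_π_cocyclesMk (A := trivialModP p Q) (B := trivialModP p G) f (𝟙 (trivialModP p G)) z h h'

/-- If $df$ is inflated from $e$ on $G/N$, then $e$ is a cocycle whose class dies in $G$.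
Injectivity gives $e=dc$ over some $G/M$, so $f-c$ is a cocycle on $G$. Surjectivity makes it $z+dg$
with $z$ inflated, and $f-dg=c+z$ is continuous. -/
theorem CohomologicallyPComplete.isAcyclic [Fact p.Prime] (hG : CohomologicallyPComplete p G) :
    (trivialModP p G).IsAcyclicModPQuotients p := by
  intro n f hf
  obtain ⟨N, e, he⟩ := hf.exists_quotient
  have hN := QuotientGroup.mk'_surjective N.toSubgroup
  have hde' : inhomogeneousCochains.d (trivialModP p G) (n + 2)
      (fun x => e (QuotientGroup.mk' N.toSubgroup ∘ x)) = 0 := by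
    rw [← he]
    exact inhomogeneousCochains_d_d (A := trivialModP p G) f
  have hde := (trivialModP_d_comp_eq_zero_iff hN e).1 hde'
  obtain ⟨M, hNM, hM⟩ := (proPComparison_injective_iff (n + 2)).1 (hG (n + 2)).1 N
    (π _ _ (cocyclesMk e hde)) <| by
      refine (modPCohomologyMap_π_cocyclesMk _ e hde hde').trans ?_
      exact (π_cocyclesMk_eq_zero_iff _ _).2 ⟨f, he⟩
  have hdM : inhomogeneousCochains.d (trivialModP p (G ⧸ M.toSubgroup)) (n + 2)
      (fun x => e (PPowerNormalSubgroup.proj hNM ∘ x)) = 0 := by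
    rw [trivialModP_d_comp, hde]
    rfl
  obtain ⟨c, hc⟩ := (π_cocyclesMk_eq_zero_iff _ hdM).1
    ((modPCohomologyMap_π_cocyclesMk _ e hde hdM).symm.trans hM)
  have hf' : inhomogeneousCochains.d (trivialModP p G) (n + 1)
      (f - fun x => c (QuotientGroup.mk' M.toSubgroup ∘ x)) = 0 := by
    refine (map_sub (inhomogeneousCochains.d (trivialModP p G) (n + 1)).hom f _).trans ?_
    refine sub_eq_zero.2 (he.trans ?_)
    refine Eq.trans ?_ (trivialModP_d_comp (QuotientGroup.mk' M.toSubgroup) c).symm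
    rw [hc]
    rfl
  obtain ⟨L, x, hx⟩ := (proPComparison_surjective_iff (n + 1)).1 (hG (n + 1)).2
    (π _ _ (cocyclesMk _ hf'))
  obtain ⟨z, hz, rfl⟩ := exists_π_cocyclesMk_eq x
  have hz' := (trivialModP_d_comp_eq_zero_iff (QuotientGroup.mk'_surjective L.toSubgroup) z).2 hz
  obtain ⟨g, hg⟩ := (π_cocyclesMk_eq_iff _ _ hf' hz').1
    (hx.symm.trans (modPCohomologyMap_π_cocyclesMk _ z hz hz'))
  refine ⟨g, ?_⟩
  rw [hg]
  convert (FactorsThroughPQuotient.of_quotient M c).map₂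
    (FactorsThroughPQuotient.of_quotient L z) (· + ·) using 1
  have key : ∀ a b c : CoeffModP.{u} p, a - (a - b - c) = b + c := fun a b c => by ring
  exact funext fun x => key _ _ _

/-- For injectivity, a primitive of an inflated cocycle can be corrected by a coboundary to a
continuous primitive. For surjectivity, a cocycle has continuous differential zero, so it is
cohomologous to a continuous cocycle. Degree 0 needs no correction, since every 0-cochain is
continuous. -/
theorem Rep.IsAcyclicModPQuotients.cohomologicallyPComplete [Fact p.Prime]
    (hG : (trivialModP p G).IsAcyclicModPQuotients p) : CohomologicallyPComplete p G := by
  have lift_eq : ∀ {n : ℕ} (N : PPowerNormalSubgroup p G)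
      {e e' : (Fin n → G ⧸ N.toSubgroup) → CoeffModP.{u} p},
      (fun x : Fin n → G => e (QuotientGroup.mk' N.toSubgroup ∘ x)) =
        (fun x => e' (QuotientGroup.mk' N.toSubgroup ∘ x)) → e = e' := by
    intro n N e e' h
    funext y
    obtain ⟨x, rfl⟩ := (QuotientGroup.mk'_surjective N.toSubgroup).comp_left y
    exact congrFun h x
  refine fun n => ⟨(proPComparison_injective_iff n).2 fun N x hx => ?_,
    (proPComparison_surjective_iff n).2 fun y => ?_⟩
  · obtain ⟨z, hz, rfl⟩ := exists_π_cocyclesMk_eq x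
    have hz' :=
      (trivialModP_d_comp_eq_zero_iff (QuotientGroup.mk'_surjective N.toSubgroup) z).2 hz
    replace hx := (modPCohomologyMap_π_cocyclesMk _ z hz hz').symm.trans hx
    cases n with
    | zero =>
      refine ⟨N, le_rfl, ?_⟩
      have : z = 0 := lift_eq N ((π_zero_cocyclesMk_eq_zero_iff _ hz').1 hx)
      rw [(π_zero_cocyclesMk_eq_zero_iff z hz).2 this, map_zero]
    | succ n =>
      obtain ⟨g, hg⟩ := (π_cocyclesMk_eq_zero_iff _ hz').1 hx
      obtain ⟨g', hg', hgp⟩ : ∃ g' : (Fin n → G) → CoeffModP.{u} p,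
          inhomogeneousCochains.d (trivialModP p G) n g' =
            inhomogeneousCochains.d (trivialModP p G) n g ∧ FactorsThroughPQuotient p g' := by
        cases n with
        | zero => exact ⟨g, rfl, .of_fin_zero _⟩
        | succ n =>
          obtain ⟨h, hh⟩ := hG n g (hg ▸ .of_quotient N z)
          refine ⟨_, ?_, hh⟩
          refine (map_sub (inhomogeneousCochains.d (trivialModP p G) (n + 1)).hom g _).trans ?_
          refine (congrArg _ (inhomogeneousCochains_d_d (A := trivialModP p G) h)).trans ?_
          exact sub_zero _
      obtain ⟨M, hNM, hM⟩ := hgp.exists_le N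
      obtain ⟨c, rfl⟩ : ∃ c : (Fin n → G ⧸ M.toSubgroup) → CoeffModP.{u} p,
          g' = fun x => c (QuotientGroup.mk' M.toSubgroup ∘ x) := by
        refine ⟨fun y => g' fun i => (y i).out, funext fun x => hM _ _ fun i => ?_⟩
        rw [← QuotientGroup.eq]
        simp
      refine ⟨M, hNM, ?_⟩
      have hzM : inhomogeneousCochains.d (trivialModP p (G ⧸ M.toSubgroup)) (n + 1)
          (fun x => z (PPowerNormalSubgroup.proj hNM ∘ x)) = 0 := by
        rw [trivialModP_d_comp, hz]
        rfl
      refine (modPCohomologyMap_π_cocyclesMk _ z hz hzM).trans ?_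
      refine (π_cocyclesMk_eq_zero_iff _ _).2 ⟨c, lift_eq M ?_⟩
      exact (trivialModP_d_comp (QuotientGroup.mk' M.toSubgroup) c).symm.trans (hg'.trans hg)
  · obtain ⟨f, hf, rfl⟩ := exists_π_cocyclesMk_eq y
    obtain ⟨f', hf', hff', hfp⟩ : ∃ (f' : (Fin n → G) → CoeffModP.{u} p)
        (hf' : inhomogeneousCochains.d (trivialModP p G) n f' = 0),
        π (trivialModP p G) n (cocyclesMk f' hf') = π (trivialModP p G) n (cocyclesMk f hf) ∧
          FactorsThroughPQuotient p f' := by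
      cases n with
      | zero => exact ⟨f, hf, rfl, .of_fin_zero _⟩
      | succ n =>
        obtain ⟨g, hg⟩ := hG n f (hf ▸ ⟨Classical.arbitrary _, fun _ _ _ => rfl⟩)
        refine ⟨_, ?_, ?_, hg⟩
        · refine (map_sub (inhomogeneousCochains.d (trivialModP p G) (n + 1)).hom f _).trans ?_
          refine (congrArg _ (inhomogeneousCochains_d_d (A := trivialModP p G) g)).trans ?_
          exact (sub_zero _).trans hf
        · refine Eq.symm ((π_cocyclesMk_eq_iff _ _ _ _).2 ⟨g, ?_⟩)
          exact (sub_sub_cancel f _).symm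
    obtain ⟨N, e, rfl⟩ := hfp.exists_quotient
    have he := (trivialModP_d_comp_eq_zero_iff (QuotientGroup.mk'_surjective N.toSubgroup) e).1 hf'
    exact ⟨N, _, (modPCohomologyMap_π_cocyclesMk _ e he hf').trans hff'⟩

end CompletenessCriterion

/-! ### Acyclicity under retracts and extensions -/

section Acyclicity

namespace Rep.IsAcyclicModPQuotients

variable {k G H : Type u} [CommRing k] [Group G] [Group H] {p : ℕ}

/-- If $\beta f-dg$ is continuous, then so is its image under $\alpha$, which is $f-d(\alpha g)$. -/
theorem of_retract {A : Rep.{u} k G} {B : Rep.{u} k H} (hA : A.IsAcyclicModPQuotients p)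
    (β : ∀ n, ((Fin n → H) → B) → ((Fin n → G) → A))
    (α : ∀ n, ((Fin n → G) → A) →+ ((Fin n → H) → B))
    (hβ : ∀ n f, inhomogeneousCochains.d A n (β n f) = β (n + 1) (inhomogeneousCochains.d B n f))
    (hα : ∀ n f, inhomogeneousCochains.d B n (α n f) = α (n + 1) (inhomogeneousCochains.d A n f))
    (hαβ : ∀ n f, α n (β n f) = f)
    (hβp : ∀ n f, FactorsThroughPQuotient p f → FactorsThroughPQuotient p (β n f))
    (hαp : ∀ n f, FactorsThroughPQuotient p f → FactorsThroughPQuotient p (α n f)) :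
    B.IsAcyclicModPQuotients p := by
  intro n f hf
  obtain ⟨g, hg⟩ := hA n (β (n + 1) f) (by rw [hβ]; exact hβp _ _ hf)
  refine ⟨α n g, ?_⟩
  rw [hα]
  nth_rw 1 [← hαβ _ f]
  rw [← map_sub]
  exact hαp _ _ hg

/-- This is the exactness argument for the quotient complexes, carried out on cochains. A merely
set-theoretic section of $q$ suffices, since composing with any function preserves continuity. -/
theorem of_shortExact [Fact p.Prime] {A B C : Rep.{u} k G} (i : A ⟶ B) (q : B ⟶ C)
    (hi : Function.Injective i.hom) (hq : Function.Surjective q.hom)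
    (hiq : ∀ b, q.hom b = 0 → ∃ a, i.hom a = b) (hB : B.ActsThroughPQuotient p)
    (hA : A.IsAcyclicModPQuotients p) (hC : C.IsAcyclicModPQuotients p) :
    B.IsAcyclicModPQuotients p := by
  have di : ∀ {n : ℕ} (z : (Fin n → G) → A), inhomogeneousCochains.d B n (fun x => i.hom (z x)) =
      fun x => i.hom (inhomogeneousCochains.d A n z x) :=
    fun z => d_cochainsMap (MonoidHom.id G) i z
  have dq : ∀ {n : ℕ} (z : (Fin n → G) → B), inhomogeneousCochains.d C n (fun x => q.hom (z x)) =
      fun x => q.hom (inhomogeneousCochains.d B n z x) :=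
    fun z => d_cochainsMap (MonoidHom.id G) q z
  obtain ⟨s, hs⟩ := hq.hasRightInverse
  intro n f hf
  obtain ⟨g, hg⟩ := hC n (fun x => q.hom (f x)) (by rw [dq]; exact hf.map q.hom)
  obtain ⟨c, hc⟩ : ∃ c, c = (fun x => q.hom (f x)) -
    (inhomogeneousCochains.d C n g : (Fin (n + 1) → G) → C) := ⟨_, rfl⟩
  rw [← hc] at hg
  obtain ⟨l, hl⟩ : ∃ l : (Fin (n + 1) → G) → B, l = fun x => s (c x) := ⟨_, rfl⟩
  have hlp : FactorsThroughPQuotient p l := hl ▸ hg.map s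
  obtain ⟨g', hg'⟩ : ∃ g' : (Fin n → G) → B, g' = fun x => s (g x) := ⟨_, rfl⟩
  have hqg' : (fun x => q.hom (g' x)) = g := by
    subst hg'
    exact funext fun x => hs _
  -- Here $f-dg'-l$ is killed by $q$, because $l$ lifts $qf-dg$ and $g'$ lifts $g$.
  obtain ⟨a, ha⟩ : ∃ a : (Fin (n + 1) → G) → A, (fun x => i.hom (a x)) =
      f - (inhomogeneousCochains.d B n g' : (Fin (n + 1) → G) → B) - l := by
    have : ∀ x, ∃ y, i.hom y =
        (f - (inhomogeneousCochains.d B n g' : (Fin (n + 1) → G) → B) - l) x := by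
      intro x
      apply hiq
      have h1 := congrFun (dq g') x
      rw [hqg'] at h1
      simp only [Pi.sub_apply, map_sub]
      rw [← h1, hl, hs, hc]
      exact sub_self _
    choose a ha using this
    exact ⟨a, funext ha⟩
  have hda : FactorsThroughPQuotient p
      (inhomogeneousCochains.d A (n + 1) a : (Fin (n + 2) → G) → A) := by
    refine FactorsThroughPQuotient.of_injective_comp hi ?_
    rw [← di, ha]
    have h2 := map_sub (inhomogeneousCochains.d B (n + 1)).hom
      (f - (inhomogeneousCochains.d B n g' : (Fin (n + 1) → G) → B)) l
    have h3 := map_sub (inhomogeneousCochains.d B (n + 1)).hom f (inhomogeneousCochains.d B n g')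
    have h4 := inhomogeneousCochains_d_d g'
    have h5 := h2.trans (congrArg (· - _) (h3.trans (congrArg (_ - ·) h4)))
    -- The differential of $f-dg'-l$ is $df-dl$, and both terms are continuous.
    refine Eq.mpr (congrArg _ h5) ?_
    rw [sub_zero]
    exact hf.map₂ (hlp.d hB) (· - ·)
  obtain ⟨g'', hg''⟩ := hA n a hda
  refine ⟨g' + fun x => i.hom (g'' x), ?_⟩
  have h6 := map_add (inhomogeneousCochains.d B n).hom g' (fun x => i.hom (g'' x))
  convert (hg''.map i.hom).map₂ hlp (· + ·) using 1
  funext x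
  have h7 := congrFun h6 x
  have h8 := congrFun (di g'') x
  have h9 := congrFun ha x
  simp only [Pi.sub_apply, map_sub] at h9 ⊢
  rw [← h8, h9]
  refine (congrArg (f x - ·) h7).trans ?_
  have key : ∀ a b c d : B, a - (b + c) = a - b - d - c + d := fun a b c d => by abel
  exact key _ _ _ _

theorem of_subsingleton {A : Rep.{u} k G} [Subsingleton A] : A.IsAcyclicModPQuotients p :=
  fun _ _ _ => ⟨0, Classical.arbitrary _, fun _ _ _ => Subsingleton.elim _ _⟩

end Rep.IsAcyclicModPQuotients

end Acyclicity

/-! ### Finite coefficients by dévissage -/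

section FiniteCoefficients

variable {p : ℕ} {G : Type u} [Group G]

theorem CoeffModP.smul_left_injective [hp : Fact p.Prime] {V : Type*} [AddCommGroup V]
    [Module (CoeffModP.{u} p) V] {v : V} (hv : v ≠ 0) :
    Function.Injective fun c : CoeffModP.{u} p => c • v := by
  intro a b hab
  by_contra hne
  have h0 : (a - b).down ≠ 0 := fun h => hne (sub_eq_zero.1 (ULift.down_injective h))
  have h1 : (ULift.up (a - b).down⁻¹ : CoeffModP.{u} p) * (a - b) = 1 :=
    ULift.down_injective (inv_mul_cancel₀ h0)
  apply hv
  rw [← one_smul (CoeffModP.{u} p) v, ← h1, mul_smul, sub_smul, sub_eq_zero.2 hab, smul_zero]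

theorem CoeffModP.dvd_natCard [hp : Fact p.Prime] (V : Type*) [AddCommGroup V]
    [Module (CoeffModP.{u} p) V] [Finite V] [Nontrivial V] : p ∣ Nat.card V := by
  obtain ⟨v, hv⟩ := exists_ne (0 : V)
  have h0 : p • v = 0 := by
    rw [← Nat.cast_smul_eq_nsmul (CoeffModP.{u} p)]
    have : ((p : ℕ) : CoeffModP.{u} p) = 0 := ULift.down_injective (by simp)
    rw [this, zero_smul]
  rw [← addOrderOf_eq_prime h0 hv]
  exact addOrderOf_dvd_natCard v

theorem PPowerNormalSubgroup.isPGroup [Fact p.Prime] (N : PPowerNormalSubgroup p G) :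
    IsPGroup p (G ⧸ N.toSubgroup) := by
  obtain ⟨k, hk⟩ := N.index_eq
  exact IsPGroup.of_card (n := k) hk

/-- A $p$-group acting on a finite set of cardinality divisible by $p$ and fixing $0$ has a second
fixed point. -/
theorem Rep.ActsThroughPQuotient.exists_fixed [hp : Fact p.Prime]
    {A : Rep.{u} (CoeffModP.{u} p) G} (hA : A.ActsThroughPQuotient p) [Finite A] [Nontrivial A] :
    ∃ v : A, v ≠ 0 ∧ ∀ g, A.ρ g v = v := by
  obtain ⟨K, hK⟩ := hA
  let φ : G ⧸ K.toSubgroup →* Module.End (CoeffModP.{u} p) A := QuotientGroup.lift _ A.ρ hK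
  let _ : MulAction (G ⧸ K.toSubgroup) A := MulAction.compHom A φ
  obtain ⟨v, hv, hv0⟩ := K.isPGroup.exists_fixed_point_of_prime_dvd_card_of_fixed_point A
    (CoeffModP.dvd_natCard A) (a := 0) (fun g => map_zero (φ g))
  exact ⟨v, hv0.symm, fun g => hv g⟩

/-- The line spanned by a nonzero fixed vector is a trivial submodule $\mathbb F_p$, and the
quotient by it is smaller, so induction on the cardinality applies. -/
theorem Rep.IsAcyclicModPQuotients.of_finite [hp : Fact p.Prime]
    (hG : (trivialModP p G).IsAcyclicModPQuotients p)
    (A : Rep.{u} (CoeffModP.{u} p) G) (hA : A.ActsThroughPQuotient p) [Finite A] :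
    A.IsAcyclicModPQuotients p := by
  induction hm : Nat.card A using Nat.strong_induction_on generalizing A with
  | _ m ih =>
  rcases subsingleton_or_nontrivial A with _ | _
  · exact .of_subsingleton
  obtain ⟨v, hv0, hv⟩ := hA.exists_fixed
  let W : Submodule (CoeffModP.{u} p) A := Submodule.span _ {v}
  have hW : ∀ g, W ≤ W.comap (A.ρ g) := by
    intro g
    rw [Submodule.span_le, Set.singleton_subset_iff]
    change A.ρ g v ∈ W
    rw [hv g]
    exact Submodule.mem_span_singleton_self v
  let i : trivialModP p G ⟶ A := Rep.ofHom
    (LinearMap.intertwiningMap_of_isIntertwiningMap _ _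
      (LinearMap.toSpanSingleton (CoeffModP.{u} p) A v) fun g c => by simp [hv])
  let C : Rep.{u} (CoeffModP.{u} p) G := Rep.of (A.ρ.quotient W hW)
  let q : A ⟶ C := Rep.ofHom
    (LinearMap.intertwiningMap_of_isIntertwiningMap _ _ W.mkQ fun g c => rfl)
  have hq : Function.Surjective q.hom := W.mkQ_surjective
  have : Finite C := Finite.of_surjective _ hq
  have hcard : Nat.card C < m := by
    rw [← hm]
    refine (Nat.card_le_card_of_surjective _ hq).lt_of_ne fun h => hv0 ?_
    have hinj := ((Nat.bijective_iff_surjective_and_card _).2 ⟨hq, h.symm⟩).1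
    apply hinj
    rw [map_zero]
    exact (Submodule.Quotient.mk_eq_zero W).2 (Submodule.mem_span_singleton_self v)
  have hC : C.ActsThroughPQuotient p := by
    obtain ⟨K, hK⟩ := hA
    refine ⟨K, fun g hg => LinearMap.ext fun x => ?_⟩
    obtain ⟨y, rfl⟩ := hq x
    exact (Rep.hom_comm_apply q g y).symm.trans (by rw [hK g hg]; rfl)
  refine .of_shortExact i q (CoeffModP.smul_left_injective hv0) hq (fun b hb => ?_) hA hG
    (ih _ hcard C hC rfl)
  exact Submodule.mem_span_singleton.1 ((Submodule.Quotient.mk_eq_zero W).1 hb)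

end FiniteCoefficients

theorem PPowerNormalSubgroup.finite_quotient {p : ℕ} [hp : Fact p.Prime] {G : Type u} [Group G]
    (N : PPowerNormalSubgroup p G) : Finite (G ⧸ N.toSubgroup) := by
  obtain ⟨k, hk⟩ := N.index_eq
  have : N.toSubgroup.FiniteIndex := ⟨by rw [hk]; exact pow_ne_zero _ hp.out.ne_zero⟩
  infer_instance

/-! ### The coinduced module of functions on the quotient -/

section CoinducedCoefficients

variable (k : Type u) [CommRing k] {G : Type u} [Group G] (H : Subgroup G) [H.Normal]

/-- The functions `G ⧸ H → k`, with the action of `G` by right translations. -/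
noncomputable def Rep.quotientFunctions : Rep.{u} k G :=
  Rep.of (X := G ⧸ H → k)
    { toFun g := LinearMap.funLeft k k fun x => x * (g : G ⧸ H)
      map_one' := by ext; simp [LinearMap.funLeft]
      map_mul' g g' := by
        ext
        simp [LinearMap.funLeft, mul_assoc] }

theorem Rep.quotientFunctions_d_apply {n : ℕ} (F : (Fin n → G) → G ⧸ H → k) (g : Fin (n + 1) → G)
    (x : G ⧸ H) :
    (inhomogeneousCochains.d (Rep.quotientFunctions k H) n F : (Fin (n + 1) → G) → G ⧸ H → k) g x =
      F (fun i => g i.succ) (x * (g 0 : G ⧸ H)) +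
        ∑ j : Fin (n + 1), (-1) ^ ((j : ℕ) + 1) * F (Fin.contractNth j (· * ·) g) x :=
  congrArg (F (fun i => g i.succ) (x * (g 0 : G ⧸ H)) + ·)
    (Finset.sum_apply (M := fun _ => k) x Finset.univ
      fun j : Fin (n + 1) => (-1 : k) ^ ((j : ℕ) + 1) • F (Fin.contractNth j (· * ·) g))

theorem Rep.trivial_d_apply {n : ℕ} (f : (Fin n → G) → k) (g : Fin (n + 1) → G) :
    (inhomogeneousCochains.d (Rep.trivial k G k) n f : (Fin (n + 1) → G) → k) g =
      f (fun i => g i.succ) +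
        ∑ j : Fin (n + 1), (-1) ^ ((j : ℕ) + 1) * f (Fin.contractNth j (· * ·) g) :=
  rfl

end CoinducedCoefficients

/-! ### From tuples in `G` to tuples in `H` via a transversal -/

section Transversal

variable {G : Type u} [Group G] (H : Subgroup G) [H.Normal]

open Classical in
/-- A set-theoretic section of the projection `G → G ⧸ H` which maps `1` to `1`. -/
noncomputable def QuotientGroup.normalizedSection {H : Subgroup G} [H.Normal] (x : G ⧸ H) : G := if x = 1 then 1 else x.out

theorem QuotientGroup.mk_normalizedSection {H : Subgroup G} [H.Normal] (x : G ⧸ H) :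
    ((normalizedSection x : G) : G ⧸ H) = x := by
  unfold normalizedSection
  split_ifs with h <;> simp [h]

/-- The cocycle of the right action of `G` on `G ⧸ H`, with values in `H`, given by the
normalized section. -/
noncomputable def QuotientGroup.sectionCocycle (x : G ⧸ H) (g : G) : H :=
  ⟨normalizedSection x * g * (normalizedSection (x * (g : G ⧸ H)))⁻¹, by
    rw [← QuotientGroup.eq_one_iff]
    simp [mk_normalizedSection]⟩

namespace QuotientGroup

theorem sectionCocycle_mul (x : G ⧸ H) (g g' : G) :
    sectionCocycle H x (g * g') =
      sectionCocycle H x g * sectionCocycle H (x * (g : G ⧸ H)) g' := by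
  ext
  simp [sectionCocycle, mul_assoc]

theorem sectionCocycle_one_coe (h : H) : sectionCocycle H 1 (h : G) = h := by
  ext
  have : ((h : G) : G ⧸ H) = 1 := (QuotientGroup.eq_one_iff _).2 h.2
  simp [sectionCocycle, normalizedSection, this]

/-- The sequence of values of `sectionCocycle` along the path which starts at `x` and has steps
`g 0, g 1, …`. -/
noncomputable def pathCocycle {n : ℕ} (x : G ⧸ H) (g : Fin n → G) (i : Fin n) : H :=
  sectionCocycle H (x * (Fin.partialProd g i.castSucc : G)) (g i)

theorem pathCocycle_tail {n : ℕ} (x : G ⧸ H) (g : Fin (n + 1) → G) :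
    (fun i : Fin n => pathCocycle H x g i.succ) =
      pathCocycle H (x * (g 0 : G ⧸ H)) fun i => g i.succ := by
  funext i
  simp only [pathCocycle, ← Fin.succ_castSucc, Fin.partialProd_succ', QuotientGroup.mk_mul,
    mul_assoc]
  rfl

/-- The cocycle identity makes the product telescope. Compatibility with contraction, hence with the
differential, follows from this. -/
theorem partialProd_pathCocycle {n : ℕ} (x : G ⧸ H) (g : Fin n → G) (i : Fin (n + 1)) :
    Fin.partialProd (pathCocycle H x g) i = sectionCocycle H x (Fin.partialProd g i) := by
  induction i using Fin.induction with
  | zero =>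
    ext
    simp [sectionCocycle]
  | succ i ih =>
    rw [Fin.partialProd_succ, Fin.partialProd_succ, ih, sectionCocycle_mul]
    rfl

theorem pathCocycle_contractNth {n : ℕ} (x : G ⧸ H) (g : Fin (n + 1) → G) (j : Fin (n + 1)) :
    pathCocycle H x (Fin.contractNth j (· * ·) g) =
      Fin.contractNth j (· * ·) (pathCocycle H x g) := by
  funext i
  rw [← Fin.inv_partialProd_mul_eq_contractNth, partialProd_pathCocycle, partialProd_pathCocycle,
    eq_inv_mul_iff_mul_eq, pathCocycle, Fin.partialProd_contractNth, Function.comp_apply,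
    ← sectionCocycle_mul, ← Fin.inv_partialProd_mul_eq_contractNth, mul_inv_cancel_left]

/-- A path with steps in $H$ starting at the trivial coset stays there, and the section is
normalized to be $1$ on it. -/
theorem pathCocycle_one_coe {n : ℕ} (h : Fin n → H) :
    pathCocycle H 1 (fun i => (h i : G)) = h := by
  funext i
  have : Fin.partialProd (fun i => (h i : G)) i.castSucc ∈ H := by
    generalize i.castSucc = j
    induction j using Fin.induction with
    | zero => simp
    | succ j ih => rw [Fin.partialProd_succ]; exact mul_mem ih (h j).2
  rw [pathCocycle, (QuotientGroup.eq_one_iff _).2 this, mul_one, sectionCocycle_one_coe]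

/-- As $M\le H$, both paths visit the same cosets, so the section values agree. The quotient of the
two entries is then the conjugate of $g_i^{-1}g'_i$ by the section value at the endpoint of the
step. -/
theorem inv_pathCocycle_mul_mem {n : ℕ} (M : Subgroup G) [M.Normal] (hM : M ≤ H) (x : G ⧸ H)
    {g g' : Fin n → G} (hg : ∀ i, (g i)⁻¹ * g' i ∈ M) (i : Fin n) :
    (((pathCocycle H x g i)⁻¹ * pathCocycle H x g' i : H) : G) ∈ M := by
  have hgg' : ∀ j, ((Fin.partialProd g j : G) : G ⧸ H) = (Fin.partialProd g' j : G) := by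
    intro j
    induction j using Fin.induction with
    | zero => simp
    | succ j ih =>
      rw [Fin.partialProd_succ, Fin.partialProd_succ, QuotientGroup.mk_mul, QuotientGroup.mk_mul,
        ih, QuotientGroup.eq.2 (hM (hg j))]
  have h1 : (g i : G ⧸ H) = g' i := QuotientGroup.eq.2 (hM (hg i))
  have h2 := Subgroup.Normal.conj_mem ‹M.Normal› _ (hg i)
    (normalizedSection (x * ((Fin.partialProd g' i.castSucc : G) : G ⧸ H) * (g' i : G ⧸ H)))
  convert h2 using 1
  simp [pathCocycle, sectionCocycle, hgg', h1, mul_assoc]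

end QuotientGroup

end Transversal

/-! ### Descent of completeness -/

section Descent

variable {p : ℕ} {G : Type u} [Group G]

/-- Shapiro's lemma at cochain level: $\beta$ evaluates on path cocycles, and $\alpha$ restricts to
the subgroup and evaluates functions at the trivial coset. -/
theorem Rep.IsAcyclicModPQuotients.of_quotientFunctions {k : Type u} [CommRing k]
    [Fact p.Prime] (K : PPowerNormalSubgroup p G)
    (h : (Rep.quotientFunctions k K.toSubgroup).IsAcyclicModPQuotients p) :
    (Rep.trivial k K.toSubgroup k).IsAcyclicModPQuotients p := by
  refine h.of_retract (β := fun n f g x => f (QuotientGroup.pathCocycle K.toSubgroup x g))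
    (α := fun n =>
      { toFun := fun F h => (F fun i => (h i : G)) (1 : G ⧸ K.toSubgroup)
        map_zero' := rfl
        map_add' := fun _ _ => rfl })
    (fun n f => ?_) (fun n F => ?_) (fun n f => ?_) (fun n f hf => ?_) (fun n F hF => ?_)
  · funext g x
    refine (Rep.quotientFunctions_d_apply k _ _ g x).trans (.trans ?_
      (Rep.trivial_d_apply k f (QuotientGroup.pathCocycle K.toSubgroup x g)).symm)
    rw [QuotientGroup.pathCocycle_tail]
    simp only [QuotientGroup.pathCocycle_contractNth]
  · funext h
    have h1 : ((h 0 : G) : G ⧸ K.toSubgroup) = 1 := (QuotientGroup.eq_one_iff _).2 (h 0).2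
    have h2 : ∀ j, (fun i => ((Fin.contractNth j (· * ·) h i : K.toSubgroup) : G)) =
        Fin.contractNth j (· * ·) fun i => (h i : G) := fun j =>
      Fin.comp_contractNth (f := ((↑) : K.toSubgroup → G)) _ _ (fun _ _ => rfl) j h
    refine (Rep.trivial_d_apply k _ h).trans (.trans ?_
      (Rep.quotientFunctions_d_apply k _ F (fun i => (h i : G)) 1).symm)
    rw [h1, mul_one]
    simp only [← h2]
    rfl
  · funext h
    exact congrArg f (QuotientGroup.pathCocycle_one_coe _ h)
  · obtain ⟨N, hN⟩ := hf
    -- $N$ need not be normal in $G$, so a subgroup of its core is used.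
    obtain ⟨M, hM, hMK⟩ := exists_ge_ge (K.core N) K
    refine ⟨M, fun g g' hg => funext fun x => hN _ _ fun i => ?_⟩
    obtain ⟨y, hy, hy'⟩ := Subgroup.normalCore_le _
      (hM (QuotientGroup.inv_pathCocycle_mul_mem K.toSubgroup M.toSubgroup hMK x hg i))
    exact Subtype.ext hy' ▸ hy
  · exact (hF.map fun φ => φ (1 : G ⧸ K.toSubgroup)).comp_hom K.toSubgroup.subtype

theorem CohomologicallyPComplete.of_normal [Fact p.Prime] (hG : CohomologicallyPComplete p G)
    (K : PPowerNormalSubgroup p G) : CohomologicallyPComplete p K.toSubgroup := by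
  have hfin : Finite (G ⧸ K.toSubgroup) := K.finite_quotient
  have : Finite (ZMod p) := inferInstance
  have hk : Finite (Rep.quotientFunctions (CoeffModP.{u} p) K.toSubgroup) :=
    inferInstanceAs (Finite (G ⧸ K.toSubgroup → CoeffModP.{u} p))
  refine Rep.IsAcyclicModPQuotients.cohomologicallyPComplete (.of_quotientFunctions K
    (hG.isAcyclic.of_finite _ ⟨K, fun g hg => ?_⟩))
  ext φ
  funext x
  change φ (x * (g : G ⧸ K.toSubgroup)) = φ x
  rw [(QuotientGroup.eq_one_iff g).2 hg, mul_one]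

theorem CohomologicallyPComplete.of_retract [Fact p.Prime] {H : Type u} [Group H]
    (hG : CohomologicallyPComplete p G) (ι : H →* G) (π : G →* H) (h : ∀ x, π (ι x) = x) :
    CohomologicallyPComplete p H := by
  refine Rep.IsAcyclicModPQuotients.cohomologicallyPComplete
    (hG.isAcyclic.of_retract (β := fun n f g => f (π ∘ g))
    (α := fun n =>
      { toFun := fun F h => F (ι ∘ h)
        map_zero' := rfl
        map_add' := fun _ _ => rfl })
    (fun n f => trivialModP_d_comp π f) (fun n F => trivialModP_d_comp ι F)
    (fun n f => funext fun x => congrArg f (funext fun i => h (x i)))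
    (fun n f hf => hf.comp_hom π) (fun n F hF => hF.comp_hom ι))

end Descent

/-! ### Descent of torsion-free quotients -/

section TorsionFreeDescent

variable {p : ℕ} {G H : Type u} [Group G] [Group H]

theorem IsTorsionFreeGroup.of_injective (hG : IsTorsionFreeGroup G) (f : H →* G)
    (hf : Function.Injective f) : IsTorsionFreeGroup H := fun _ hx =>
  hf ((hG _ (f.isOfFinOrder hx)).trans (map_one f).symm)

theorem QuotientGroup.map_comap_injective (f : H →* G) (U : Subgroup G) [U.Normal] :
    Function.Injective (QuotientGroup.map (U.comap f) U f le_rfl) := by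
  rw [injective_iff_map_eq_one]
  intro x
  induction x using QuotientGroup.induction_on with
  | H x =>
    intro hx
    rw [QuotientGroup.map_mk, QuotientGroup.eq_one_iff] at hx
    exact (QuotientGroup.eq_one_iff _).2 hx

/-- If every normal subgroup of `p`-power index in `H` contains the preimage of one in `G`, then
`H` inherits torsion-free elementary amenable quotients from `G`. -/
theorem HasEnoughTorsionFreeQuotients.of_comap_le (hG : HasEnoughTorsionFreeQuotients p G)
    (f : H →* G)
    (hf : ∀ (V : Subgroup H) [V.Normal], Finite (H ⧸ V) → IsPGroup p (H ⧸ V) →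
      ∃ (W : Subgroup G) (_ : W.Normal), Finite (G ⧸ W) ∧ IsPGroup p (G ⧸ W) ∧ W.comap f ≤ V) :
    HasEnoughTorsionFreeQuotients p H := by
  intro V _ hfin hp
  obtain ⟨W, _, hW1, hW2, hWV⟩ := hf V hfin hp
  obtain ⟨U, _, hUW, htf, hea⟩ := hG W hW1 hW2
  have hinj := QuotientGroup.map_comap_injective f U
  exact ⟨U.comap f, inferInstance, (Subgroup.comap_mono hUW).trans hWV,
    htf.of_injective _ hinj, hea.of_injective _ hinj⟩

theorem HasEnoughTorsionFreeQuotients.of_normal [hp : Fact p.Prime]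
    (hG : HasEnoughTorsionFreeQuotients p G) (K : PPowerNormalSubgroup p G) :
    HasEnoughTorsionFreeQuotients p K.toSubgroup := by
  refine hG.of_comap_le K.toSubgroup.subtype fun V _ hfin hV => ?_
  let M := K.core ⟨V, inferInstance, IsPGroup.iff_card.1 hV⟩
  refine ⟨M.toSubgroup, inferInstance, M.finite_quotient, M.isPGroup, fun x hx => ?_⟩
  obtain ⟨y, hy, hy'⟩ := Subgroup.normalCore_le _ hx
  exact Subtype.ext hy' ▸ hy

theorem HasEnoughTorsionFreeQuotients.of_retract (hG : HasEnoughTorsionFreeQuotients p G)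
    (ι : H →* G) (π : G →* H) (h : ∀ x, π (ι x) = x) : HasEnoughTorsionFreeQuotients p H := by
  refine hG.of_comap_le ι fun V _ hfin hV => ?_
  have hinj := QuotientGroup.map_comap_injective π V
  -- The quotient of $G$ by $\pi^{-1}(V)$ embeds in $H/V$, and $\pi\circ\iota=\mathrm{id}$ pulls
  -- $\pi^{-1}(V)$ back to $V$.
  refine ⟨V.comap π, inferInstance, Finite.of_injective _ hinj, hV.of_injective _ hinj, ?_⟩
  intro x hx
  simpa [h] using hx

end TorsionFreeDescent

theorem mainTheorem4 {G : Type u} [Group G] (p : ℕ) (hp : p.Prime) (H : Subgroup G) :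
    ((H.Normal ∧ ∃ k : ℕ, H.index = p ^ k) →
      (CohomologicallyPComplete p G → CohomologicallyPComplete p H) ∧
      (HasEnoughTorsionFreeQuotients p G → HasEnoughTorsionFreeQuotients p H)) ∧
    (H.IsRetractOf →
      (CohomologicallyPComplete p G → CohomologicallyPComplete p H) ∧
      (HasEnoughTorsionFreeQuotients p G → HasEnoughTorsionFreeQuotients p H)) := by
  have : Fact p.Prime := ⟨hp⟩
  refine ⟨fun ⟨hH, hk⟩ => ?_, fun ⟨π, hπ⟩ => ?_⟩
  · let K : PPowerNormalSubgroup p G := ⟨H, hH, hk⟩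
    exact ⟨fun hG => hG.of_normal K, fun hG => hG.of_normal K⟩
  · exact ⟨fun hG => hG.of_retract H.subtype π hπ, fun hG => hG.of_retract H.subtype π hπ⟩
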